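/- Let $F_0=0$, $F_1=1$, $F_k=F_{k-1}+F_{k-2}$ be the Fibonacci numbers and $\gamma=(1+\sqrt5)/2$. A function $f:\mathbb{N}_0\to\mathbb{R}$ is called Z-additive if $f(0)=0$ and $f(n)=\sum_{i} f(F_{i})$ for $n\ge 1$, where the sum runs over the indices $i\ge 2$ occurring in the Zeckendorf expansion of $n$ (the unique representation of $n$ as a sum of pairwise non-consecutive Fibonacci numbers $F_i$, $i\ge2$). For $N\ge1$ let $F_N(y)=\frac1N\#\{n<N: f(n)\le y\}$ (from here on $F_N$ denotes this function when it is compared with $F$, whereas $F_j$ inside $f(F_j)$ is a Fibonacci number). A limiting distribution function of $f$ is a probability distribution function $F$ such that $F_N(y)\to F(y)$ as $N\to\infty$ at every continuity point $y$ of $F$; its concentration function is $Q_F(u)=\sup_{z\in\mathbb{R}}\,(F(z+u)-F(z))$ for $u>0$. **Theorem (effective Zeckendorf Erdős–Wintner).** There is an absolute constant $C>0$ such that the following holds. Let $f$ be a real-valued Z-additive function for which $\sum_{j\ge2}|f(F_j)|$ converges. Then $f$ has a limiting distribution function $F$, and for all integers $N\ge2$ and all real numbers $T\ge1$ such that, with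 $$L=\lceil\log_\gamma(\sqrt5\,N)\rceil,\qquad h=\lceil\log_\gamma(T\log T)\rceil$$ (and $h=0$ if $T=1$), one has $h\le L/2$, we have $$\|F_N-F\|_\infty\le C\Bigl(Q_F(1/T)+\frac{\log N}{T}+T\sum_{j>L-2h+1}|f(F_j)|\Bigr).$$ -/

import Mathlib

namespace ZeckendorfEW

/-- A real-valued function on the non-negative integers is Z-additive if its value at `n` is the
sum of its values at the Fibonacci numbers in the Zeckendorf expansion of `n`. Here
`Nat.zeckendorf n` is the list of the indices `i ≥ 2` of these Fibonacci numbers; it is empty for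
`n = 0`, so `f 0 = 0`. -/
def IsZAdditive (f : ℕ → ℝ) : Prop :=
  ∀ n : ℕ, f n = ((Nat.zeckendorf n).map (fun i => f (Nat.fib i))).sum

/-- The distribution function `F_N` of the finite sequence `(f n : n < N)`. -/
noncomputable def empiricalDF (f : ℕ → ℝ) (N : ℕ) (y : ℝ) : ℝ :=
  (((Finset.range N).filter (fun n => f n ≤ y)).card : ℝ) / (N : ℝ)

/-- `F` is a (probability) distribution function on the real line. -/
structure IsDistributionFunction (F : ℝ → ℝ) : Prop where
  mono : Monotone F
  right_continuous : ∀ y : ℝ, ContinuousWithinAt F (Set.Ici y) y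
  tendsto_atBot : Filter.Tendsto F Filter.atBot (nhds 0)
  tendsto_atTop : Filter.Tendsto F Filter.atTop (nhds 1)

/-- `F` is the limiting distribution function of `f`: it is a distribution function and
`F_N → F` weakly, that is, at every continuity point of `F`. -/
structure IsLimitingDF (f : ℕ → ℝ) (F : ℝ → ℝ) : Prop where
  isDistributionFunction : IsDistributionFunction F
  tendsto : ∀ y : ℝ, ContinuousAt F y →
    Filter.Tendsto (fun N : ℕ => empiricalDF f N y) Filter.atTop (nhds (F y))

/-- The concentration function `Q_F(h) = sup_z (F(z + h) - F(z))`. -/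
noncomputable def concentration (F : ℝ → ℝ) (h : ℝ) : ℝ :=
  ⨆ z : ℝ, (F (z + h) - F z)

/-- The uniform distance `‖F - G‖_∞` (of bounded functions). -/
noncomputable def supDist (F G : ℝ → ℝ) : ℝ :=
  ⨆ y : ℝ, |F y - G y|

end ZeckendorfEW

/-!
Cut the Zeckendorf expansion of `n` at the index `K`. The high digits change `f n` by at most the
tail `s = ∑_{j > K} |f (F_j)|`, so only the law of the low digits matters, up to a translation by
`s`. An event `P` that depends on the low digits only has a density with bounded discrepancy:
`#{n < N : P n} = θ N + O(F_{K+1})` (`exists_density`). Indeed `a_i = #{n < F_i : P n}` satisfies the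
Fibonacci recurrence for `i ≥ K`, and with `θ` chosen to remove the growing solution the
discrepancies `a_i - θ F_i` decay geometrically like powers of the conjugate `ψ` of the golden
ratio; the greedy expansion of `N` then adds up a convergent geometric series.

Hence there is a function `θ` with `F_N(y) ≤ θ(y + s) + ε_N` and `θ(y) ≤ F_N(y + s) + ε_N`, where
`ε_N = 4 F_{K+1} / N` (`exists_truncated_law`). Letting `N → ∞` along an ultrafilter and then `K → ∞`
gives a limiting distribution (`exists_isLimitingDF`). Comparing `F_N` with the limit `F` at the same
level `K` gives `F_N(y) ≤ F(y + 2s) + ε_N` and a matching lower bound.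

For `K = L - 2h + 1` and `T ≥ 3`, `ε_N` is of order `T⁻²`. If `s T < 1` the translations by `2s` cost at
most `2 Q_F(1/T)`; if `s T ≥ 1`, or if `T < 3`, the bound is trivial. No Fourier analysis
(Berry–Esseen inequality) is needed.
-/

namespace ZeckendorfEW

open Filter Topology Real

/-! ### Density of events depending on low Zeckendorf digits -/

theorem zeckendorf_fib_add {i m : ℕ} (hi : 1 ≤ i) (hm : m < Nat.fib i) :
    Nat.zeckendorf (Nat.fib (i + 1) + m) = (i + 1) :: Nat.zeckendorf m := by
  have hg : Nat.greatestFib (Nat.fib (i + 1) + m) = i + 1 := by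
    apply le_antisymm
    · rw [← Nat.lt_succ_iff, Nat.greatestFib_lt, Nat.succ_eq_add_one, Nat.fib_add_two]
      omega
    · rw [Nat.le_greatestFib]
      omega
  have hpos : 0 < Nat.fib (i + 1) := Nat.fib_pos.2 (by omega)
  rw [Nat.zeckendorf_of_pos (by omega), hg, Nat.add_sub_cancel_left]

theorem nodup_zeckendorf (n : ℕ) : (Nat.zeckendorf n).Nodup := by
  have h := Nat.isZeckendorfRep_zeckendorf n
  have h1 : (Nat.zeckendorf n ++ [0]).IsChain (fun a b => b < a) :=
    h.imp fun a b hab => by omega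
  have h2 := (List.isChain_iff_pairwise.1 h1).imp (S := fun a b => a ≠ b)
    fun {a b} hab => Nat.ne_of_gt hab
  exact List.Nodup.of_append_left h2

/-- A predicate invariant under adding a leading Fibonacci number of index above `K` has a density,
with discrepancy bounded by `4 * fib (K + 1)` uniformly in the length of the interval. -/
theorem exists_density (P : ℕ → Prop) [DecidablePred P] (K : ℕ)
    (hP : ∀ i, K ≤ i → ∀ m < Nat.fib i, (P (Nat.fib (i + 1) + m) ↔ P m)) :
    ∃ θ : ℝ, ∀ N : ℕ, |(Nat.count P N : ℝ) - θ * N| ≤ 4 * Nat.fib (K + 1) := by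
  have hφ := goldenRatio_pos
  have hψ := goldenConj_neg
  have hφψ : goldenRatio * goldenConj = -1 := goldenRatio_mul_goldenConj
  have hφ3 : goldenRatio + goldenConj = 1 := goldenRatio_add_goldenConj
  have hcount : ∀ i, K ≤ i → ∀ m ≤ Nat.fib i,
      Nat.count P (Nat.fib (i + 1) + m) = Nat.count P (Nat.fib (i + 1)) + Nat.count P m := by
    intro i hi m hm
    rw [Nat.count_add]
    congr 1
    apply le_antisymm
    · exact Nat.count_mono_left fun k hk h => (hP i hi k (by omega)).1 h
    · exact Nat.count_mono_left fun k hk h => (hP i hi k (by omega)).2 h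
  set a : ℕ → ℝ := fun i => (Nat.count P (Nat.fib i) : ℝ) with ha
  have ha0 : ∀ i, 0 ≤ a i := fun i => Nat.cast_nonneg _
  have ha1 : ∀ i, a i ≤ Nat.fib i := fun i => Nat.cast_le.2 (Nat.count_le P)
  have harec : ∀ i, K ≤ i → a (i + 2) = a (i + 1) + a i := by
    intro i hi
    have := hcount i hi (Nat.fib i) le_rfl
    simp only [ha]
    rw [Nat.fib_add_two, add_comm (Nat.fib i), this]
    push_cast
    ring
  -- the value of `θ` that kills the component of `a` along the powers of the golden ratio
  set θ : ℝ := (goldenRatio * a (K + 1) + a K) / goldenRatio ^ (K + 1) with hθ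
  have hfib := goldenRatio_mul_fib_succ_add_fib K
  have hpow : 0 < goldenRatio ^ (K + 1) := by positivity
  have hθ0 : 0 ≤ θ := by
    have := ha0 K
    have := ha0 (K + 1)
    positivity
  have hθ1 : θ ≤ 1 := by
    rw [hθ, div_le_one hpow, ← hfib]
    have := ha1 K
    have := ha1 (K + 1)
    gcongr
  set δ : ℕ → ℝ := fun i => a i - θ * Nat.fib i with hδ
  have hδ0 : goldenRatio * δ (K + 1) + δ K = 0 := by
    have h : θ * goldenRatio ^ (K + 1) = goldenRatio * a (K + 1) + a K := by
      rw [hθ]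
      field_simp
    rw [← hfib] at h
    simp only [hδ]
    linear_combination -h
  have hδrec : ∀ i, K ≤ i → δ (i + 2) = δ (i + 1) + δ i := by
    intro i hi
    simp only [hδ]
    rw [harec i hi, Nat.fib_add_two]
    push_cast
    ring
  have hδψ : ∀ i, K ≤ i → δ (i + 1) = goldenConj * δ i := by
    intro i hi
    induction i, hi using Nat.le_induction with
    | base => linear_combination (-goldenConj) * hδ0 + δ (K + 1) * hφψ
    | succ i hi ih =>
      rw [hδrec i hi]
      have : δ i = -goldenRatio * δ (i + 1) := by
        rw [ih]
        linear_combination δ i * hφψ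
      rw [this]
      linear_combination (-δ (i + 1)) * hφ3
  have hsmall : |goldenConj| ≤ 2 / 3 := by
    rw [abs_of_neg hψ]
    have := goldenConj_sq
    nlinarith
  have hdecay : ∀ i, K ≤ i → |δ (i + 1)| ≤ 2 / 3 * |δ i| := by
    intro i hi
    rw [hδψ i hi, abs_mul]
    gcongr
  have htriv : ∀ N : ℕ, |(Nat.count P N : ℝ) - θ * N| ≤ N := by
    intro N
    have h1 : (Nat.count P N : ℝ) ≤ N := Nat.cast_le.2 (Nat.count_le P)
    have h2 : (0 : ℝ) ≤ Nat.count P N := Nat.cast_nonneg _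
    have h3 : (0 : ℝ) ≤ N := Nat.cast_nonneg _
    rw [abs_le]
    constructor <;> nlinarith
  -- the subtracted term `3 * |δ j|` makes the induction absorb the geometric series
  have key : ∀ j, K + 1 ≤ j → ∀ N ≤ Nat.fib j,
      |(Nat.count P N : ℝ) - θ * N| ≤ Nat.fib (K + 1) + 3 * (|δ (K + 1)| - |δ j|) := by
    intro j hj
    induction j, hj using Nat.le_induction with
    | base =>
      intro N hN
      have : (N : ℝ) ≤ Nat.fib (K + 1) := Nat.cast_le.2 hN
      linarith [htriv N]
    | succ j hj ih =>
      intro N hN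
      have hd := hdecay j (by omega)
      have hj0 := abs_nonneg (δ j)
      obtain hle | hlt := le_total N (Nat.fib j)
      · linarith [ih N hle]
      · obtain ⟨i, rfl⟩ : ∃ i, j = i + 1 := ⟨j - 1, by omega⟩
        obtain ⟨m, rfl⟩ := Nat.exists_eq_add_of_le hlt
        have hm : m ≤ Nat.fib i := by
          rw [Nat.fib_add_two] at hN
          omega
        have h1 := ih m (hm.trans (Nat.fib_mono (Nat.le_succ i)))
        have h2 := hcount i (by omega) m hm
        have h3 : (Nat.count P (Nat.fib (i + 1) + m) : ℝ) - θ * ((Nat.fib (i + 1) + m : ℕ) : ℝ)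
            = δ (i + 1) + ((Nat.count P m : ℝ) - θ * m) := by
          rw [h2]
          simp only [hδ, ha]
          push_cast
          ring
        rw [h3]
        have h4 := abs_add_le (δ (i + 1)) ((Nat.count P m : ℝ) - θ * m)
        linarith
  refine ⟨θ, fun N => ?_⟩
  have hN : N ≤ Nat.fib (N + K + 5) :=
    le_trans (by omega) (Nat.le_fib_self (show 5 ≤ N + K + 5 by omega))
  have h1 := key _ (by omega) N hN
  have h2 : |δ (K + 1)| ≤ Nat.fib (K + 1) := htriv (Nat.fib (K + 1))
  linarith [abs_nonneg (δ (N + K + 5))]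

/-! ### Truncation of an additive function -/

/-- The part of `f n` that comes from the Zeckendorf digits of index at most `K`. -/
noncomputable def lowPart (f : ℕ → ℝ) (K n : ℕ) : ℝ :=
  ∑ j ∈ (Nat.zeckendorf n).toFinset.filter (· ≤ K), f (Nat.fib j)

/-- The tail `∑_{j > K} |f (F_j)|`. -/
noncomputable def tail (f : ℕ → ℝ) (K : ℕ) : ℝ :=
  ∑' j : {j : ℕ // K < j}, |f (Nat.fib j)|

theorem lowPart_fib_add (f : ℕ → ℝ) {K i m : ℕ} (hK : 1 ≤ K) (hi : K ≤ i) (hm : m < Nat.fib i) :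
    lowPart f K (Nat.fib (i + 1) + m) = lowPart f K m := by
  rw [lowPart, zeckendorf_fib_add (hK.trans hi) hm, List.toFinset_cons, Finset.filter_insert,
    if_neg (by omega), lowPart]

theorem tail_nonneg (f : ℕ → ℝ) (K : ℕ) : 0 ≤ tail f K :=
  tsum_nonneg fun _ => abs_nonneg _

theorem tendsto_tail (f : ℕ → ℝ) : Tendsto (tail f) atTop (𝓝 0) := by
  have h := (tendsto_tsum_compl_atTop_zero (fun j : ℕ => |f (Nat.fib j)|)).comp
    (tendsto_finset_range.comp (tendsto_add_atTop_nat 1))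
  refine h.congr fun K => ?_
  have hp : (fun j : ℕ => j ∉ Finset.range (K + 1)) = fun j => K < j := by
    ext j
    simp only [Finset.mem_range]
    omega
  change (∑' j : Subtype (fun j : ℕ => j ∉ Finset.range (K + 1)), |f (Nat.fib j)|) = _
  rw [hp]
  rfl

theorem abs_sub_lowPart_le {f : ℕ → ℝ} (hf : IsZAdditive f)
    (hs : Summable fun j : ℕ => |f (Nat.fib j)|) (K n : ℕ) :
    |f n - lowPart f K n| ≤ tail f K := by
  have h1 : f n = ∑ j ∈ (Nat.zeckendorf n).toFinset, f (Nat.fib j) := by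
    rw [List.sum_toFinset _ (nodup_zeckendorf n)]
    exact hf n
  rw [h1, lowPart, ← Finset.sum_filter_add_sum_filter_not _ (· ≤ K), add_sub_cancel_left]
  refine (Finset.abs_sum_le_sum_abs _ _).trans ?_
  have h2 : Summable fun j : {j : ℕ // K < j} => |f (Nat.fib j)| := hs.subtype _
  have h3 := h2.sum_le_tsum
    ((Nat.zeckendorf n).toFinset.subtype (K < ·)) (fun _ _ => abs_nonneg _)
  rw [Finset.sum_subtype_eq_sum_filter (f := fun j => |f (Nat.fib j)|)] at h3
  simp only [not_le]
  exact h3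

theorem abs_le_tsum {f : ℕ → ℝ} (hf : IsZAdditive f)
    (hs : Summable fun j : ℕ => |f (Nat.fib j)|) (n : ℕ) :
    |f n| ≤ ∑' j, |f (Nat.fib j)| := by
  have h1 : f n = ∑ j ∈ (Nat.zeckendorf n).toFinset, f (Nat.fib j) := by
    rw [List.sum_toFinset _ (nodup_zeckendorf n)]
    exact hf n
  rw [h1]
  exact (Finset.abs_sum_le_sum_abs _ _).trans (hs.sum_le_tsum _ fun _ _ => abs_nonneg _)

/-! ### Comparison of empirical distributions with a truncated law -/

theorem empiricalDF_nonneg (f : ℕ → ℝ) (N : ℕ) (y : ℝ) : 0 ≤ empiricalDF f N y := by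
  unfold empiricalDF
  positivity

theorem empiricalDF_le_one (f : ℕ → ℝ) (N : ℕ) (y : ℝ) : empiricalDF f N y ≤ 1 := by
  refine div_le_one_of_le₀ ?_ (Nat.cast_nonneg _)
  exact_mod_cast (Finset.card_filter_le _ _).trans (Finset.card_range N).le

theorem empiricalDF_le_of_imp {f g : ℕ → ℝ} {y z : ℝ} (h : ∀ n, f n ≤ y → g n ≤ z) (N : ℕ) :
    empiricalDF f N y ≤ empiricalDF g N z := by
  unfold empiricalDF
  have hsub := Finset.card_le_card
    (Finset.monotone_filter_right (Finset.range N) fun n _ hn => h n hn)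
  gcongr

/-- At every truncation level `K` a single function `θ` (the law of the low part of `f`) is close
to every `F_N`, up to a translation by the tail and an error `4 * fib (K + 1) / N`. -/
theorem exists_truncated_law {f : ℕ → ℝ} (hf : IsZAdditive f)
    (hs : Summable fun j : ℕ => |f (Nat.fib j)|) {K : ℕ} (hK : 1 ≤ K) :
    ∃ θ : ℝ → ℝ, ∀ N : ℕ, 1 ≤ N → ∀ y : ℝ,
      empiricalDF f N y ≤ θ (y + tail f K) + 4 * Nat.fib (K + 1) / N ∧
      θ y ≤ empiricalDF f N (y + tail f K) + 4 * Nat.fib (K + 1) / N := by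
  classical
  have hd : ∀ y : ℝ, ∃ θ : ℝ, ∀ N : ℕ,
      |(Nat.count (fun n => lowPart f K n ≤ y) N : ℝ) - θ * N| ≤ 4 * Nat.fib (K + 1) :=
    fun y => exists_density _ K fun i hi m hm => by rw [lowPart_fib_add f hK hi hm]
  choose θ hθ using hd
  have hlow : ∀ N : ℕ, 1 ≤ N → ∀ y : ℝ,
      |empiricalDF (lowPart f K) N y - θ y| ≤ 4 * Nat.fib (K + 1) / N := by
    intro N hN y
    have hN' : (0 : ℝ) < N := by exact_mod_cast hN
    have h := hθ y N
    rw [Nat.count_eq_card_filter_range] at h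
    have hmul : (empiricalDF (lowPart f K) N y - θ y) * N
        = (((Finset.range N).filter fun n => lowPart f K n ≤ y).card : ℝ) - θ y * N := by
      rw [sub_mul, empiricalDF, div_mul_cancel₀ _ hN'.ne']
    rw [le_div_iff₀ hN']
    calc |empiricalDF (lowPart f K) N y - θ y| * N
        = |(empiricalDF (lowPart f K) N y - θ y) * N| := by rw [abs_mul, abs_of_pos hN']
      _ ≤ _ := by
        rw [hmul]
        convert h
  have hdiff := abs_sub_lowPart_le hf hs K
  refine ⟨θ, fun N hN y => ⟨?_, ?_⟩⟩
  · have h1 : empiricalDF f N y ≤ empiricalDF (lowPart f K) N (y + tail f K) :=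
      empiricalDF_le_of_imp (fun n hn => by linarith [(abs_le.1 (hdiff n)).1]) N
    linarith [(abs_le.1 (hlow N hN (y + tail f K))).2]
  · have h1 : empiricalDF (lowPart f K) N y ≤ empiricalDF f N (y + tail f K) :=
      empiricalDF_le_of_imp (fun n hn => by linarith [(abs_le.1 (hdiff n)).2]) N
    linarith [(abs_le.1 (hlow N hN y)).1]

theorem tendsto_error (K : ℕ) :
    Tendsto (fun N : ℕ => (4 * Nat.fib (K + 1) : ℝ) / N) atTop (𝓝 0) :=
  tendsto_const_nhds.div_atTop tendsto_natCast_atTop_atTop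

/-! ### Existence of the limiting distribution -/

/-- Any limit `U` of `F_M` along a filter finer than `atTop` is close to every `F_N`. -/
theorem empiricalDF_close_of_tendsto {f : ℕ → ℝ} (hf : IsZAdditive f)
    (hs : Summable fun j : ℕ => |f (Nat.fib j)|) {l : Filter ℕ} [l.NeBot] (hl : l ≤ atTop)
    {K : ℕ} (hK : 1 ≤ K) {N : ℕ} (hN : 1 ≤ N) {y u : ℝ} :
    (Tendsto (fun M => empiricalDF f M (y + 2 * tail f K)) l (𝓝 u) →
      empiricalDF f N y ≤ u + 4 * Nat.fib (K + 1) / N) ∧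
    (Tendsto (fun M => empiricalDF f M (y - 2 * tail f K)) l (𝓝 u) →
      u ≤ empiricalDF f N y + 4 * Nat.fib (K + 1) / N) := by
  obtain ⟨θ, hθ⟩ := exists_truncated_law hf hs hK
  have hε := (tendsto_error K).mono_left hl
  have hM : ∀ᶠ M : ℕ in l, 1 ≤ M := hl (eventually_ge_atTop 1)
  constructor
  · intro hu
    have h1 : θ (y + tail f K) ≤ u + 0 := by
      refine ge_of_tendsto (hu.add hε) (hM.mono fun M hM => ?_)
      have := (hθ M hM (y + tail f K)).2
      rwa [show y + tail f K + tail f K = y + 2 * tail f K by ring] at this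
    linarith [(hθ N hN y).1]
  · intro hu
    have h1 : u ≤ θ (y - tail f K) + 0 := by
      refine le_of_tendsto_of_tendsto hu (tendsto_const_nhds.add hε) (hM.mono fun M hM => ?_)
      have := (hθ M hM (y - 2 * tail f K)).1
      rwa [show y - 2 * tail f K + tail f K = y - tail f K by ring] at this
    have h2 := (hθ N hN (y - tail f K)).2
    rw [sub_add_cancel] at h2
    linarith

theorem exists_isLimitingDF {f : ℕ → ℝ} (hf : IsZAdditive f)
    (hs : Summable fun j : ℕ => |f (Nat.fib j)|) : ∃ F : ℝ → ℝ, IsLimitingDF f F := by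
  have hl : (hyperfilter ℕ : Filter ℕ) ≤ atTop := Nat.hyperfilter_le_atTop
  -- compactness of `[0, 1]` gives a pointwise limit along an ultrafilter
  have hU : ∀ y : ℝ, ∃ u, Tendsto (fun M => empiricalDF f M y) (hyperfilter ℕ) (𝓝 u) := by
    intro y
    obtain ⟨u, -, hu⟩ := (isCompact_Icc (a := (0 : ℝ)) (b := 1)).ultrafilter_le_nhds
      ((hyperfilter ℕ).map fun M => empiricalDF f M y)
      (by
        rw [le_principal_iff]
        exact mem_map.2 (univ_mem'
          fun M => ⟨empiricalDF_nonneg f M y, empiricalDF_le_one f M y⟩))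
    exact ⟨u, hu⟩
  choose U hU using hU
  have hmono : Monotone U := fun y z hyz =>
    le_of_tendsto_of_tendsto' (hU y) (hU z) fun M =>
      empiricalDF_le_of_imp (fun n hn => hn.trans hyz) M
  set A : ℝ := ∑' j, |f (Nat.fib j)| with hA
  have hbd := abs_le_tsum hf hs
  have hU0 : ∀ y < -A, U y = 0 := by
    intro y hy
    refine tendsto_nhds_unique (hU y) (tendsto_const_nhds.congr fun M => ?_)
    rw [empiricalDF, Finset.filter_false_of_mem]
    · simp
    · intro n _ hn
      linarith [(abs_le.1 (hbd n)).1]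
  have hU1 : ∀ y, A ≤ y → U y = 1 := by
    intro y hy
    refine tendsto_nhds_unique (hU y) (tendsto_const_nhds.congr' ?_)
    filter_upwards [hl (eventually_ge_atTop 1)] with M hM
    rw [empiricalDF, Finset.filter_true_of_mem, Finset.card_range, div_self]
    · exact_mod_cast Nat.one_le_iff_ne_zero.1 hM
    · intro n _
      linarith [(abs_le.1 (hbd n)).2]
  set F := hmono.stieltjesFunction with hF
  have hFeq : ∀ y, F y = Function.rightLim U y := hmono.stieltjesFunction_eq
  have hUF : ∀ y, U y ≤ F y := fun y => by
    rw [hFeq]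
    exact hmono.le_rightLim le_rfl
  have hFU : ∀ y z, y < z → F y ≤ U z := fun y z hyz => by
    rw [hFeq]
    exact hmono.rightLim_le hyz
  refine ⟨F, ⟨F.mono, F.right_continuous, ?_, ?_⟩, ?_⟩
  · refine tendsto_const_nhds.congr' ?_
    filter_upwards [eventually_lt_atBot (-A - 1)] with y hy
    apply le_antisymm
    · rw [← hU0 y (by linarith)]
      exact hUF y
    · rw [← hU0 (y + 1) (by linarith)]
      exact hFU y _ (by linarith)
  · refine tendsto_const_nhds.congr' ?_
    filter_upwards [eventually_ge_atTop A] with y hy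
    apply le_antisymm
    · rw [← hU1 y hy]
      exact hUF y
    · rw [← hU1 (y + 1) (by linarith)]
      exact hFU y _ (by linarith)
  · intro y hy
    rw [Metric.tendsto_atTop]
    intro η hη
    obtain ⟨r, hr, hFr⟩ := Metric.continuousAt_iff.1 hy (η / 2) (by linarith)
    have hz : ∀ z, |z - y| < r → |F z - F y| < η / 2 := fun z hz => by
      have := @hFr z (by rwa [Real.dist_eq])
      rwa [Real.dist_eq] at this
    have hz1 := abs_lt.1 (hz (y - r / 2) (by rw [abs_lt]; constructor <;> linarith))
    have hz2 := abs_lt.1 (hz (y + r / 2) (by rw [abs_lt]; constructor <;> linarith))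
    obtain ⟨K, hK, hKs⟩ := ((eventually_ge_atTop 1).and
      ((tendsto_tail f).eventually_lt_const (show (0 : ℝ) < r / 4 by linarith))).exists
    obtain ⟨N₀, hN₀⟩ := eventually_atTop.1
      ((tendsto_error K).eventually_lt_const (show (0 : ℝ) < η / 2 by linarith))
    refine ⟨max N₀ 1, fun N hN => ?_⟩
    have hε := hN₀ N (le_of_max_le_left hN)
    have hN1 : 1 ≤ N := le_of_max_le_right hN
    have hcl := fun u => empiricalDF_close_of_tendsto hf hs hl hK hN1 (y := y) (u := u)
    have h1 := (hcl _).1 (hU _)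
    have h2 := (hcl _).2 (hU _)
    have h3 : U (y + 2 * tail f K) ≤ F (y + r / 2) :=
      (hmono (by linarith)).trans (hUF _)
    have h4 : F (y - r / 2) ≤ U (y - 2 * tail f K) := hFU _ _ (by linarith)
    rw [Real.dist_eq, abs_lt]
    constructor <;> linarith

/-! ### The effective bound -/

theorem IsDistributionFunction.nonneg {F : ℝ → ℝ} (hF : IsDistributionFunction F) (y : ℝ) :
    0 ≤ F y :=
  hF.mono.le_of_tendsto hF.tendsto_atBot y

theorem IsDistributionFunction.le_one {F : ℝ → ℝ} (hF : IsDistributionFunction F) (y : ℝ) :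
    F y ≤ 1 :=
  hF.mono.ge_of_tendsto hF.tendsto_atTop y

theorem IsDistributionFunction.sub_le_concentration {F : ℝ → ℝ} (hF : IsDistributionFunction F)
    (u z : ℝ) : F (z + u) - F z ≤ concentration F u := by
  refine le_ciSup (f := fun z => F (z + u) - F z) ⟨1, ?_⟩ z
  rintro _ ⟨w, rfl⟩
  linarith [hF.nonneg w, hF.le_one (w + u)]

theorem IsDistributionFunction.concentration_nonneg {F : ℝ → ℝ} (hF : IsDistributionFunction F)
    {u : ℝ} (hu : 0 ≤ u) : 0 ≤ concentration F u := by
  have h := hF.sub_le_concentration u 0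
  have h2 : F 0 ≤ F (0 + u) := hF.mono (by linarith)
  linarith

theorem supDist_empiricalDF_le_one {F : ℝ → ℝ} (hF : IsDistributionFunction F) (f : ℕ → ℝ)
    (N : ℕ) : supDist (empiricalDF f N) F ≤ 1 := by
  refine ciSup_le fun y => abs_le.2 ⟨?_, ?_⟩
  · linarith [empiricalDF_nonneg f N y, hF.le_one y]
  · linarith [empiricalDF_le_one f N y, hF.nonneg y]

theorem exists_continuousAt_between {F : ℝ → ℝ} (hF : Monotone F) {a b : ℝ} (hab : a < b) :
    ∃ w, ContinuousAt F w ∧ a < w ∧ w < b := by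
  obtain ⟨w, hw, h⟩ := (hF.countable_not_continuousAt.dense_compl ℝ).exists_between hab
  exact ⟨w, not_not.1 hw, h.1, h.2⟩

/-- If the translation `2 * tail f K` is less than `2 * u`, it costs at most `2 Q_F(u)`. -/
theorem supDist_empiricalDF_le {f : ℕ → ℝ} (hf : IsZAdditive f)
    (hs : Summable fun j : ℕ => |f (Nat.fib j)|) {F : ℝ → ℝ} (hF : IsLimitingDF f F)
    {K : ℕ} (hK : 1 ≤ K) {N : ℕ} (hN : 1 ≤ N) {u : ℝ} (hu : tail f K < u) :
    supDist (empiricalDF f N) F ≤ 2 * concentration F u + 4 * Nat.fib (K + 1) / N := by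
  have hD := hF.isDistributionFunction
  have hcl := fun y v => empiricalDF_close_of_tendsto hf hs le_rfl hK hN (y := y) (u := v)
  refine ciSup_le fun y => abs_le.2 ⟨?_, ?_⟩
  · obtain ⟨w, hw, hw1, hw2⟩ := exists_continuousAt_between hD.mono
      (show y - 2 * u < y - 2 * tail f K by linarith)
    have h1 := (hcl (w + 2 * tail f K) (F w)).2 (by
      rw [add_sub_cancel_right]
      exact hF.tendsto w hw)
    have h2 : empiricalDF f N (w + 2 * tail f K) ≤ empiricalDF f N y :=
      empiricalDF_le_of_imp (fun n hn => by linarith) N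
    have h3 : F (y - 2 * u) ≤ F w := hD.mono hw1.le
    have h4 := hD.sub_le_concentration u (y - 2 * u)
    have h5 := hD.sub_le_concentration u (y - u)
    rw [show y - 2 * u + u = y - u by ring] at h4
    rw [sub_add_cancel] at h5
    linarith
  · obtain ⟨w, hw, hw1, hw2⟩ := exists_continuousAt_between hD.mono
      (show y + 2 * tail f K < y + 2 * u by linarith)
    have h1 := (hcl (w - 2 * tail f K) (F w)).1 (by
      rw [sub_add_cancel]
      exact hF.tendsto w hw)
    have h2 : empiricalDF f N y ≤ empiricalDF f N (w - 2 * tail f K) :=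
      empiricalDF_le_of_imp (fun n hn => by linarith) N
    have h3 : F w ≤ F (y + 2 * u) := hD.mono hw2.le
    have h4 := hD.sub_le_concentration u y
    have h5 := hD.sub_le_concentration u (y + u)
    rw [show y + u + u = y + 2 * u by ring] at h5
    linarith

/-- With the cut at `K = L - 2h + 1`, `fib (K + 1) / N` is at most of order `γ ^ (-2h) ≤ T⁻²`. -/
theorem fib_cut_le {N : ℕ} (hN : 2 ≤ N) {T : ℝ} (hT : 3 ≤ T) {L h : ℤ} {K : ℕ}
    (hL : L = ⌈logb goldenRatio (√5 * (N : ℝ))⌉) (hh : h = ⌈logb goldenRatio (T * log T)⌉)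
    (hK : (K : ℤ) = L - 2 * h + 1) : (Nat.fib (K + 1) : ℝ) / N ≤ 10 / T ^ 2 := by
  have hφ := goldenRatio_pos
  have hφ1 := one_lt_goldenRatio
  have hφ2 := goldenRatio_lt_two
  have hN0 : (0 : ℝ) < N := by
    have : 0 < N := by omega
    exact_mod_cast this
  have hT0 : 0 < T := by linarith
  have hlog : 1 ≤ log T := by
    rw [le_log_iff_exp_le hT0]
    linarith [exp_one_lt_d9]
  have hγh : T ≤ goldenRatio ^ h := by
    have h1 : logb goldenRatio (T * log T) ≤ h := by
      rw [hh]
      exact Int.le_ceil _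
    rw [logb_le_iff_le_rpow hφ1 (by positivity), rpow_intCast] at h1
    nlinarith
  have hγL : goldenRatio ^ L ≤ goldenRatio * (√5 * N) := by
    have h1 : (L : ℝ) - 1 ≤ logb goldenRatio (√5 * N) := by
      have := Int.ceil_lt_add_one (logb goldenRatio (√5 * (N : ℝ)))
      rw [← hL] at this
      linarith
    rw [le_logb_iff_rpow_le hφ1 (by positivity), rpow_sub_one hφ.ne', rpow_intCast,
      div_le_iff₀ hφ] at h1
    linarith
  have hfib : (Nat.fib (K + 1) : ℝ) ≤ goldenRatio ^ K := by
    have h1 := goldenRatio_mul_fib_succ_add_fib K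
    have h2 : (0 : ℝ) ≤ Nat.fib K := Nat.cast_nonneg _
    rw [pow_succ'] at h1
    exact le_of_mul_le_mul_left (by linarith) hφ
  have hsplit : goldenRatio ^ K * (goldenRatio ^ h) ^ 2 = goldenRatio ^ L * goldenRatio := by
    rw [← zpow_natCast, hK, pow_two, ← zpow_add₀ hφ.ne', ← zpow_add₀ hφ.ne',
      ← zpow_add_one₀ hφ.ne']
    congr 1
    ring
  have h5 : √5 ≤ 5 / 2 := by
    rw [sqrt_le_left (by norm_num)]
    norm_num
  rw [div_le_div_iff₀ hN0 (by positivity)]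
  calc (Nat.fib (K + 1) : ℝ) * T ^ 2 ≤ goldenRatio ^ K * (goldenRatio ^ h) ^ 2 := by gcongr
    _ = goldenRatio ^ L * goldenRatio := hsplit
    _ ≤ goldenRatio * (√5 * N) * goldenRatio := by gcongr
    _ = goldenRatio * √5 * goldenRatio * N := by ring
    _ ≤ 2 * (5 / 2) * 2 * N := by gcongr
    _ = 10 * N := by ring

theorem summable_of_subtype_two_le {f : ℕ → ℝ}
    (hs : Summable (fun j : {j : ℕ // 2 ≤ j} => |f (Nat.fib j)|)) :
    Summable fun j : ℕ => |f (Nat.fib j)| := by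
  rw [← summable_nat_add_iff 2]
  exact hs.comp_injective (i := fun n : ℕ => (⟨n + 2, by omega⟩ : {j : ℕ // 2 ≤ j}))
    fun a b hab => by simpa using hab

end ZeckendorfEW

theorem mainTheorem2 :
    ∃ C : ℝ, 0 < C ∧
      ∀ f : ℕ → ℝ, ZeckendorfEW.IsZAdditive f →
        Summable (fun j : {j : ℕ // 2 ≤ j} => |f (Nat.fib j)|) →
        (∃ F : ℝ → ℝ, ZeckendorfEW.IsLimitingDF f F) ∧
        ∀ F : ℝ → ℝ, ZeckendorfEW.IsLimitingDF f F →
          ∀ N : ℕ, 2 ≤ N → ∀ T : ℝ, 1 ≤ T → ∀ L h : ℤ,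
            L = ⌈Real.logb Real.goldenRatio (Real.sqrt 5 * (N : ℝ))⌉ →
            h = ⌈Real.logb Real.goldenRatio (T * Real.log T)⌉ →
            (h : ℝ) ≤ (L : ℝ) / 2 →
            ZeckendorfEW.supDist (ZeckendorfEW.empiricalDF f N) F ≤
              C * (ZeckendorfEW.concentration F (1 / T) + Real.log (N : ℝ) / T +
                T * ∑' j : {j : ℕ // L - 2 * h + 1 < (j : ℤ)}, |f (Nat.fib j)|) := by
  refine ⟨40, by norm_num, fun f hf hs₂ => ?_⟩
  have hs := ZeckendorfEW.summable_of_subtype_two_le hs₂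
  refine ⟨ZeckendorfEW.exists_isLimitingDF hf hs, ?_⟩
  intro F hF N hN T hT L h hL hh hle
  have hD := hF.isDistributionFunction
  have hT0 : 0 < T := by linarith
  have hhL : 2 * h ≤ L := by
    have : (2 * h : ℝ) ≤ L := by linarith
    exact_mod_cast this
  obtain ⟨K, hK⟩ := Int.eq_ofNat_of_zero_le (show 0 ≤ L - 2 * h + 1 by omega)
  have hK1 : 1 ≤ K := by omega
  have htail : ∑' j : {j : ℕ // L - 2 * h + 1 < (j : ℤ)}, |f (Nat.fib j)|
      = ZeckendorfEW.tail f K := by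
    have hp : (fun j : ℕ => L - 2 * h + 1 < (j : ℤ)) = fun j => K < j := by
      ext j
      omega
    change ∑' j : Subtype (fun j : ℕ => L - 2 * h + 1 < (j : ℤ)), |f (Nat.fib j)| = _
    rw [hp]
    rfl
  rw [htail]
  have htriv := ZeckendorfEW.supDist_empiricalDF_le_one hD f N
  have hQ := hD.concentration_nonneg (show 0 ≤ 1 / T by positivity)
  have hS := mul_nonneg hT0.le (ZeckendorfEW.tail_nonneg f K)
  have hlogN : 1 / 2 ≤ Real.log N := by
    have h1 : Real.log 2 ≤ Real.log N := Real.log_le_log (by norm_num) (by exact_mod_cast hN)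
    linarith [Real.log_two_gt_d9]
  have hlogT : 1 / 2 / T ≤ Real.log N / T := by gcongr
  obtain hT3 | hT3 := lt_or_ge T 3
  -- `log N / T` is bounded below; this covers `T = 1`, where `h` comes from `logb γ 0 = 0`
  · have h1 : 1 / 2 / 3 ≤ 1 / 2 / T := by gcongr
    linarith
  obtain hsT | hsT := le_or_gt 1 (T * ZeckendorfEW.tail f K)
  · have h1 : 0 < 1 / 2 / T := by positivity
    linarith
  have hmain := ZeckendorfEW.supDist_empiricalDF_le hf hs hF hK1 (show 1 ≤ N by omega)
    (show ZeckendorfEW.tail f K < 1 / T by rw [lt_div_iff₀ hT0]; linarith)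
  have hcut := ZeckendorfEW.fib_cut_le hN hT3 hL hh hK.symm
  have h10 : 10 / T ^ 2 ≤ 10 / (3 * T) := by
    gcongr
    nlinarith
  have h11 : 10 / (3 * T) = 20 / 3 * (1 / 2 / T) := by
    field_simp
    norm_num
  rw [mul_div_assoc] at hmain
  have hT1 : 0 < 1 / 2 / T := by positivity
  linarith
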